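/- All spaces are assumed to be completely regular and Hausdorff; $\beta X$ denotes the Čech–Stone compactification of $X$, with $X\subseteq\beta X$. A set $A\subseteq\mathbb{R}^\omega$ is *analytic* if it is empty or a continuous image of the space of irrationals (equivalently, of $\omega^\omega$). A map is *perfect* if it is continuous, closed, and has compact fibres. A space $X$ is called - *proper $K$-analytic* if there is a perfect map from $X$ onto an analytic subspace of $\mathbb{R}^\omega$; - *Čech-complete* if $X$ is a $G_\delta$ subset of $\beta X$; - *$K$-analytic* if $X$ is a continuous image of a Lindelöf Čech-complete space; - a *$p$-space* if there is a sequence $(\mathcal{U}_n)_{n<\omega}$ of families of open subsets of $\beta X$, each covering $X$, such that $\bigcap_{n<\omega}\mathrm{St}(x,\mathcal{U}_n)\subseteq X$ for every $x\in X$, where $\mathrm{St}(x,\mathcal{U}_n)=\bigcup\{U\in\mathcal{U}_n : x\in U\}$. **Theorem.** A space $X$ is proper $K$-analytic if and only if $X$ is a $K$-analytic $p$-space. -/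

import Mathlib

universe u

/-- A Čech-complete space: a Tychonoff space (`T35Space`: completely regular and Hausdorff) that is
a `G_δ` subset of its Čech–Stone compactification `βX`. -/
structure IsCechComplete (X : Type u) [TopologicalSpace X] : Prop where
  tychonoff : T35Space X
  isGδ_range : IsGδ (Set.range (stoneCechUnit : X → StoneCech X))

/-- A `K`-analytic space: a continuous image of a Lindelöf Čech-complete space. -/
def IsKAnalyticSpace (X : Type u) [TopologicalSpace X] : Prop :=
  ∃ (Z : Type u) (_ : TopologicalSpace Z) (f : Z → X),
    LindelofSpace Z ∧ IsCechComplete Z ∧ Continuous f ∧ Function.Surjective f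

/-- A proper `K`-analytic space: a perfect pre-image of an analytic subspace `A` of `ℝ^ω`.
For a Hausdorff domain `IsProperMap` says exactly that the map is perfect, i.e. continuous and
closed with compact fibres (`isProperMap_iff_isClosedMap_and_compact_fibers`). -/
def IsProperKAnalyticSpace (X : Type u) [TopologicalSpace X] : Prop :=
  ∃ A : Set (ℕ → ℝ), MeasureTheory.AnalyticSet A ∧
    ∃ f : X → A, IsProperMap f ∧ Function.Surjective f

/-- The star `St(y, 𝒰)` of a point `y` with respect to a family `𝒰` of sets. -/
def pointStar {Y : Type u} (y : Y) (𝒰 : Set (Set Y)) : Set Y :=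
  ⋃₀ {U | U ∈ 𝒰 ∧ y ∈ U}

/-- A `p`-space in the sense of Arhangel'skii (for a Tychonoff space `X`): there are countably many
families `𝒰 n` of open subsets of `βX`, each of which covers `X`, such that
`⋂ n, St(x, 𝒰 n) ⊆ X` for every point `x` of `X`. -/
def IsPSpace (X : Type u) [TopologicalSpace X] : Prop :=
  ∃ 𝒰 : ℕ → Set (Set (StoneCech X)),
    (∀ n, ∀ U ∈ 𝒰 n, IsOpen U) ∧
    (∀ n, Set.range (stoneCechUnit : X → StoneCech X) ⊆ ⋃₀ 𝒰 n) ∧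
    ∀ x : X, ⋂ n, pointStar (stoneCechUnit x) (𝒰 n) ⊆
      Set.range (stoneCechUnit : X → StoneCech X)

/-!
The theorem rests on one description of perfect maps inside compactifications. If `h : Z → Y` is
perfect and `Y` is embedded in a Hausdorff space `K`, then every continuous extension
`H : βZ → K` of `h` satisfies `H ⁻¹ Y = Z` (`IsProperMap.preimage_range_subset_range`); conversely,
if `X` sits in a compact space `B` and `G : B → K` is continuous with `G ⁻¹ (G X) = X`, then `G`
restricts to a perfect map of `X` onto `G X` (`isProperMap_rangeFactorization_of_preimage_subset`).

Let `f : X → A` be perfect onto an analytic set `A = g (ℕ^ℕ)`. The pullback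
`Z = {(x, s) | f x = g s}` maps onto `X` and is perfect over `ℕ^ℕ`. It is therefore Lindelöf, and it
is the preimage in `βZ` of the `G_δ` subset `ℕ^ℕ` of `(ℕ ∪ {∞})^ℕ`, so it is Čech-complete and `X` is
`K`-analytic. Moreover `X` is the preimage of `A` under the extension of `f` from `βX` to the
compact metrizable space `[-∞, ∞]^ℕ`; pulling back the balls of radius `1 / (n + 1)` gives the
families which witness that `X` is a `p`-space.

Let now `X` be a `K`-analytic `p`-space. As `X` is Lindelöf, each of the families can be refined,
over `X`, by countably many cozero sets of `βX`. The diagonal `G : βX → ℝ^ℕ` of the functions that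
define these sets satisfies `G ⁻¹ (G X) = X`, because a point `p` with `G p = G x` lies in the same
cozero sets as `x`, hence in all the stars of `x`. So `G` restricts to a perfect map on `X`. Its
image is a continuous image of a Lindelöf Čech-complete space `Z`, and such an image is analytic
(`analyticSet_range_of_isCechComplete`): since `Z` is a `K_σδ` set `⋂ n, ⋃ k, K n k` in `βZ`, the
set of all `(s, φ z)` with `z ∈ ⋂ n, K n (s n)` is closed in `ℕ^ℕ × ℝ^ℕ`, and it projects onto
`φ Z`.
-/

open Set Filter Topology MeasureTheory

/-! ### Perfect maps and compactifications -/

/-- A continuous extension of a perfect map to a larger space in which the domain is dense sends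
no new point into the original codomain. -/
lemma IsProperMap.preimage_range_subset_range {Z Y B K : Type*} [TopologicalSpace Z]
    [TopologicalSpace Y] [TopologicalSpace B] [TopologicalSpace K] [T2Space B]
    {h : Z → Y} (hh : IsProperMap h) {e : Y → K} (he : IsInducing e) {j : Z → B}
    (hj : DenseRange j) (hjc : Continuous j) {H : B → K} (hH : Continuous H)
    (hHj : ∀ z, H (j z) = e (h z)) : H ⁻¹' range e ⊆ range j := by
  rintro p ⟨y, hy⟩
  have : NeBot (comap j (𝓝 p)) := comap_neBot_iff_frequently.2 <| by
    have := mem_closure_iff_frequently.1 (hj p)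
    exact this.mono fun q ⟨z, hz⟩ => ⟨z, hz⟩
  let u := Ultrafilter.of (comap j (𝓝 p))
  have hup : Tendsto j u (𝓝 p) := tendsto_comap.mono_left (Ultrafilter.of_le _)
  have huy : Tendsto h u (𝓝 y) := by
    rw [he.tendsto_nhds_iff, hy]
    exact ((hH.tendsto p).comp hup).congr hHj
  obtain ⟨z, -, hz⟩ := hh.ultrafilter_le_nhds_of_tendsto huy
  exact ⟨z, tendsto_nhds_unique ((hjc.tendsto z).mono_left hz) hup⟩

/-- If a subspace of a compact space is saturated for a continuous map, then that map restricts to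
a perfect map from the subspace onto its image. -/
lemma isProperMap_rangeFactorization_of_preimage_subset {X B Y : Type*} [TopologicalSpace X]
    [TopologicalSpace B] [TopologicalSpace Y] [CompactSpace B] [T2Space Y] {j : X → B}
    (hj : IsInducing j) {G : B → Y} (hG : Continuous G)
    (hsat : G ⁻¹' range (G ∘ j) ⊆ range j) : IsProperMap (rangeFactorization (G ∘ j)) := by
  rw [isProperMap_iff_ultrafilter_of_t2]
  refine ⟨(hG.comp hj.continuous).subtype_mk _, fun u y hy => ?_⟩
  let p := (u.map j).lim
  have hp : Tendsto j u (𝓝 p) := (u.map j).le_nhds_lim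
  have hy' : Tendsto (G ∘ j) u (𝓝 (y : Y)) := (continuous_subtype_val.tendsto y).comp hy
  have hpy : G p = y := tendsto_nhds_unique ((hG.tendsto p).comp hp) hy'
  obtain ⟨x, hx⟩ : p ∈ range j := hsat (by rw [mem_preimage, hpy]; exact y.2)
  refine ⟨x, ?_⟩
  rw [hj.nhds_eq_comap, hx]
  exact hp.le_comap

lemma IsProperMap.lindelofSpace {X Y : Type*} [TopologicalSpace X] [TopologicalSpace Y]
    [LindelofSpace Y] {f : X → Y} (hf : IsProperMap f) : LindelofSpace X := by
  refine ⟨fun l _ _ _ => ?_⟩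
  obtain ⟨y, hy⟩ := cluster_point_of_Lindelof (map f l)
  obtain ⟨x, -, hx⟩ := hf.clusterPt_of_mapClusterPt hy
  exact ⟨x, mem_univ x, hx⟩

/-- The Baire space is a `G_δ` subset of its compactification `(ℕ ∪ {∞})^ℕ`. -/
lemma isGδ_range_piMap_natCast :
    IsGδ (range (Pi.map fun _ => ((↑) : ℕ → ℕ∞) : (ℕ → ℕ) → (ℕ → ℕ∞))) := by
  have : range (Pi.map fun _ => ((↑) : ℕ → ℕ∞) : (ℕ → ℕ) → (ℕ → ℕ∞)) =
      ⋂ n, (fun s : ℕ → ℕ∞ => s n) ⁻¹' range ((↑) : ℕ → ℕ∞) := by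
    rw [range_piMap]
    ext s
    simp
  rw [this]
  exact .iInter_of_isOpen fun n =>
    ENat.isOpenEmbedding_natCast.isOpen_range.preimage (continuous_apply n)

lemma IsProperMap.isCechComplete {Z : Type*} [TopologicalSpace Z] [T35Space Z]
    {h : Z → ℕ → ℕ} (hh : IsProperMap h) : IsCechComplete Z := by
  refine ⟨inferInstance, ?_⟩
  have he : IsEmbedding (Pi.map fun _ => ((↑) : ℕ → ℕ∞) : (ℕ → ℕ) → (ℕ → ℕ∞)) :=
    .piMap fun _ => ENat.isEmbedding_natCast
  have hc := he.continuous.comp hh.continuous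
  convert! isGδ_range_piMap_natCast.preimage (continuous_stoneCechExtend hc) using 1
  refine Subset.antisymm ?_ (hh.preimage_range_subset_range he.isInducing denseRange_stoneCechUnit
    continuous_stoneCechUnit (continuous_stoneCechExtend hc) (stoneCechExtend_stoneCechUnit hc))
  rintro _ ⟨z, rfl⟩
  exact ⟨h z, (stoneCechExtend_stoneCechUnit hc z).symm⟩

/-! ### Perfect preimages of analytic sets -/

lemma IsProperKAnalyticSpace.isKAnalyticSpace {X : Type u} [TopologicalSpace X] [T35Space X]
    (hX : IsProperKAnalyticSpace X) : IsKAnalyticSpace X := by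
  obtain ⟨A, hA, f, hf, hfs⟩ := hX
  rw [AnalyticSet] at hA
  rcases hA with rfl | ⟨g, hg, rfl⟩
  · -- Over the empty set, `X` is empty and serves as its own Čech-complete source.
    have : IsEmpty X := ⟨fun x => (f x).2⟩
    refine ⟨X, inferInstance, id, inferInstance, ⟨inferInstance, ?_⟩, continuous_id,
      Function.surjective_id⟩
    rw [range_eq_empty]
    exact .empty
  let Z := {q : X × (ℕ → ℕ) // (f q.1 : ℕ → ℝ) = g q.2}
  have hfc : Continuous fun x => (f x : ℕ → ℝ) := continuous_subtype_val.comp hf.continuous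
  have hproper : IsProperMap fun z : Z => z.1.2 := by
    rw [isProperMap_iff_ultrafilter_of_t2]
    refine ⟨by fun_prop, fun u s hs => ?_⟩
    have hfu : Tendsto (fun z : Z => f z.1.1) u (𝓝 ⟨g s, mem_range_self s⟩) := by
      rw [tendsto_subtype_rng]
      exact ((hg.tendsto s).comp hs).congr fun z => z.2.symm
    obtain ⟨x, hx, hux⟩ := hf.ultrafilter_le_nhds_of_tendsto
      (𝒰 := u.map fun z : Z => z.1.1) hfu
    refine ⟨⟨(x, s), by simp [hx]⟩, ?_⟩
    have : Tendsto (id : Z → Z) u (𝓝 ⟨(x, s), by simp [hx]⟩) := by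
      rw [tendsto_subtype_rng]
      exact Tendsto.prodMk_nhds hux hs
    exact this
  refine ⟨Z, inferInstance, fun z => z.1.1, hproper.lindelofSpace, hproper.isCechComplete,
    by fun_prop, fun x => ?_⟩
  obtain ⟨s, hs⟩ := (f x).2
  exact ⟨⟨(x, s), hs.symm⟩, rfl⟩

/-- A perfect preimage of a subspace of `ℝ^ℕ` is a `p`-space: the families are the preimages in `βX`
of the balls of a metric on the compactification `[-∞, ∞]^ℕ` of `ℝ^ℕ`. -/
lemma IsProperMap.isPSpace {X : Type u} [TopologicalSpace X] {A : Set (ℕ → ℝ)} {f : X → A}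
    (hf : IsProperMap f) : IsPSpace X := by
  let e : A → ℕ → EReal := fun a n => ((a : ℕ → ℝ) n : EReal)
  have he : IsEmbedding e :=
    (IsEmbedding.piMap fun _ : ℕ => EReal.isEmbedding_coe).comp .subtypeVal
  have hc : Continuous (e ∘ f) := he.continuous.comp hf.continuous
  have hsub := hf.preimage_range_subset_range he.isInducing denseRange_stoneCechUnit
    continuous_stoneCechUnit (continuous_stoneCechExtend hc) (stoneCechExtend_stoneCechUnit hc)
  let H := stoneCechExtend hc
  let : MetricSpace (ℕ → EReal) := TopologicalSpace.metrizableSpaceMetric _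
  refine ⟨fun n => range fun k => H ⁻¹' Metric.ball k (1 / (n + 1 : ℝ)), ?_, ?_, ?_⟩
  · rintro n _ ⟨k, rfl⟩
    exact Metric.isOpen_ball.preimage (continuous_stoneCechExtend hc)
  · rintro n p -
    exact ⟨_, ⟨H p, rfl⟩, Metric.mem_ball_self Nat.one_div_pos_of_nat⟩
  · intro x p hp
    rw [mem_iInter] at hp
    have hdist : ∀ n : ℕ, dist (H p) (H (stoneCechUnit x)) ≤ 2 * (1 / (n + 1 : ℝ)) := by
      intro n
      obtain ⟨_, ⟨⟨k, rfl⟩, hx⟩, hpk⟩ := hp n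
      have h₁ := Metric.mem_ball.1 hpk
      have h₂ := Metric.mem_ball.1 hx
      linarith [dist_triangle_right (H p) (H (stoneCechUnit x)) k]
    have hzero : dist (H p) (H (stoneCechUnit x)) ≤ 2 * 0 :=
      ge_of_tendsto' (tendsto_one_div_add_atTop_nhds_zero_nat.const_mul 2) hdist
    have hEq : H p = H (stoneCechUnit x) := dist_le_zero.1 (by simpa using hzero)
    exact hsub ⟨f x, (hEq.trans (stoneCechExtend_stoneCechUnit hc x)).symm⟩

/-! ### Continuous images of Lindelöf Čech-complete spaces -/

/-- A Lindelöf Čech-complete space is a `K_σδ` subset of its Čech–Stone compactification. -/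
lemma IsCechComplete.exists_range_eq_iInter_iUnion {Z : Type u} [TopologicalSpace Z]
    [LindelofSpace Z] [Nonempty Z] (hZ : IsCechComplete Z) :
    ∃ K : ℕ → ℕ → Set (StoneCech Z), (∀ n k, IsClosed (K n k)) ∧
      range (stoneCechUnit : Z → StoneCech Z) = ⋂ n, ⋃ k, K n k := by
  obtain ⟨O, hO, hrange⟩ := isGδ_iff_eq_iInter_nat.1 hZ.isGδ_range
  have hmem : ∀ n (z : Z), O n ∈ 𝓝 (stoneCechUnit z) := fun n z =>
    (hO n).mem_nhds (mem_iInter.1 (hrange ▸ mem_range_self z) n)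
  choose C hC hCc hCO using fun n z => exists_mem_nhds_isClosed_subset (hmem n z)
  have hcover : ∀ n, ∃ z : ℕ → Z, ∀ x, ∃ k, stoneCechUnit x ∈ C n (z k) := by
    intro n
    obtain ⟨t, ht, htU⟩ := LindelofSpace.elim_nhds_subcover
      (fun z : Z => stoneCechUnit ⁻¹' C n z) fun z =>
        continuous_stoneCechUnit.continuousAt.preimage_mem_nhds (hC n z)
    obtain ⟨z, hz⟩ := countable_iff_exists_subset_range.1 ht
    refine ⟨z, fun x => ?_⟩
    obtain ⟨y, hy, hxy⟩ := mem_iUnion₂.1 (htU ▸ mem_univ x)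
    obtain ⟨k, rfl⟩ := hz hy
    exact ⟨k, hxy⟩
  choose z hz using hcover
  refine ⟨fun n k => C n (z n k), fun n k => hCc n _, Subset.antisymm ?_ ?_⟩
  · rintro _ ⟨x, rfl⟩
    exact mem_iInter.2 fun n => mem_iUnion.2 (hz n x)
  · rw [hrange]
    exact iInter_mono fun n => iUnion_subset fun k => hCO n _

lemma analyticSet_range_of_isCechComplete {Z : Type u} {Y : Type*} [TopologicalSpace Z]
    [LindelofSpace Z] (hZ : IsCechComplete Z) [TopologicalSpace Y] [PolishSpace Y] {φ : Z → Y}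
    (hφ : Continuous φ) : AnalyticSet (range φ) := by
  cases isEmpty_or_nonempty Z
  · rw [range_eq_empty]
    exact analyticSet_empty
  obtain ⟨K, hK, hrange⟩ := hZ.exists_range_eq_iInter_iUnion
  have := hZ.tychonoff
  let P := {q : (ℕ → ℕ) × Z // ∀ n, stoneCechUnit q.2 ∈ K n (q.1 n)}
  -- Since the `K n k` are closed in `βZ` and all their relevant intersections lie in `Z`,
  -- the set `P` is closed in `ℕ^ℕ × βZ`, so it is perfect over `ℕ^ℕ`.
  have hproper : IsProperMap fun q : P => q.1.1 := by
    rw [isProperMap_iff_ultrafilter_of_t2]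
    refine ⟨by fun_prop, fun u s hs => ?_⟩
    let p := (u.map fun q : P => stoneCechUnit q.1.2).lim
    have hp : Tendsto (fun q : P => stoneCechUnit q.1.2) u (𝓝 p) :=
      (u.map fun q : P => stoneCechUnit q.1.2).le_nhds_lim
    have hpK : ∀ n, p ∈ K n (s n) := by
      intro n
      refine (hK n (s n)).mem_of_tendsto hp ?_
      have hn : ∀ᶠ q : P in u, q.1.1 n = s n := by
        have := ((continuous_apply n).tendsto s).comp hs
        rw [nhds_discrete, tendsto_pure] at this
        exact this
      filter_upwards [hn] with q hq
      exact hq ▸ q.2 n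
    obtain ⟨z, hz⟩ : p ∈ range (stoneCechUnit : Z → StoneCech Z) := by
      rw [hrange]
      exact mem_iInter.2 fun n => mem_iUnion.2 ⟨s n, hpK n⟩
    refine ⟨⟨(s, z), fun n => hz ▸ hpK n⟩, ?_⟩
    have : Tendsto (id : P → P) u (𝓝 ⟨(s, z), fun n => hz ▸ hpK n⟩) := by
      rw [tendsto_subtype_rng]
      refine Tendsto.prodMk_nhds hs ?_
      rw [isInducing_stoneCechUnit.tendsto_nhds_iff, hz]
      exact hp
    exact this
  let F : P → (ℕ → ℕ) × Y := fun q => (q.1.1, φ q.1.2)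
  have hF : IsProperMap F :=
    isProperMap_of_comp_of_t2 (g := Prod.fst) (by fun_prop) continuous_fst hproper
  have hsnd : range φ = Prod.snd '' range F := by
    rw [← range_comp]
    refine Subset.antisymm ?_ ?_
    · rintro _ ⟨z, rfl⟩
      have hz : ∀ n, ∃ k, stoneCechUnit z ∈ K n k := fun n =>
        mem_iUnion.1 (mem_iInter.1 (hrange ▸ mem_range_self z) n)
      choose s hs using hz
      exact ⟨⟨(s, z), hs⟩, rfl⟩
    · rintro _ ⟨q, rfl⟩
      exact ⟨q.1.2, rfl⟩
  rw [hsnd]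
  exact hF.isClosed_range.analyticSet.image_of_continuous continuous_snd

/-! ### Lindelöf `p`-spaces -/

/-- A Lindelöf `p`-space is saturated in `βX` for some continuous map `βX → ℝ^ℕ`. -/
lemma IsPSpace.exists_continuous_preimage_subset {X : Type u} [TopologicalSpace X]
    [LindelofSpace X] [Nonempty X] (hX : IsPSpace X) :
    ∃ G : StoneCech X → ℕ → ℝ, Continuous G ∧
      G ⁻¹' range (G ∘ stoneCechUnit) ⊆ range (stoneCechUnit : X → StoneCech X) := by
  obtain ⟨𝒰, hopen, hcover, hstar⟩ := hX
  have hmem : ∀ n (x : X), ∃ U ∈ 𝒰 n, stoneCechUnit x ∈ U := fun n x =>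
    hcover n (mem_range_self x)
  choose U hU hxU using hmem
  -- `g n x` is positive at `x` and its cozero set lies in the member `U n x` of `𝒰 n`.
  have hfun : ∀ n (x : X), ∃ g : C(StoneCech X, ℝ), g (stoneCechUnit x) ≠ 0 ∧
      ∀ p, g p ≠ 0 → p ∈ U n x := by
    intro n x
    obtain ⟨g, hg0, hg1, -⟩ := exists_continuous_zero_one_of_isClosed
      (hopen n _ (hU n x)).isClosed_compl isClosed_singleton
      (disjoint_singleton_right.2 (notMem_compl_iff.2 (hxU n x)))
    refine ⟨g, ?_, fun p hp => ?_⟩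
    · rw [hg1 rfl]
      exact one_ne_zero
    · by_contra hpU
      exact hp (hg0 hpU)
  choose g hgx hgU using hfun
  have hseq : ∀ n, ∃ c : ℕ → X, ∀ x, ∃ k, g n (c k) (stoneCechUnit x) ≠ 0 := by
    intro n
    obtain ⟨t, ht, htU⟩ := LindelofSpace.elim_nhds_subcover
      (fun y : X => {x | g n y (stoneCechUnit x) ≠ 0}) fun y =>
        (isOpen_ne_fun ((g n y).continuous.comp continuous_stoneCechUnit)
          continuous_const).mem_nhds (hgx n y)
    obtain ⟨c, hc⟩ := countable_iff_exists_subset_range.1 ht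
    refine ⟨c, fun x => ?_⟩
    obtain ⟨y, hy, hxy⟩ := mem_iUnion₂.1 (htU ▸ mem_univ x)
    obtain ⟨k, rfl⟩ := hc hy
    exact ⟨k, hxy⟩
  choose c hc using hseq
  refine ⟨fun p m => g m.unpair.1 (c m.unpair.1 m.unpair.2) p,
    continuous_pi fun m => (g _ _).continuous, ?_⟩
  rintro p ⟨x, hx⟩
  refine hstar x (mem_iInter.2 fun n => ?_)
  obtain ⟨k, hk⟩ := hc n x
  have hpx : g n (c n k) (stoneCechUnit x) = g n (c n k) p := by
    simpa using congrFun hx (Nat.pair n k)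
  exact ⟨U n (c n k), ⟨hU n _, hgU n _ _ hk⟩, hgU n _ _ (hpx ▸ hk)⟩

theorem mainTheorem11 (X : Type u) [TopologicalSpace X] [T35Space X] :
    IsProperKAnalyticSpace X ↔ IsKAnalyticSpace X ∧ IsPSpace X := by
  refine ⟨fun hX => ⟨hX.isKAnalyticSpace, ?_⟩, ?_⟩
  · obtain ⟨A, -, f, hf, -⟩ := hX
    exact hf.isPSpace
  rintro ⟨⟨Z, _, φ, _, hZ, hφ, hφs⟩, hp⟩
  cases isEmpty_or_nonempty X
  · exact ⟨∅, analyticSet_empty, isEmptyElim,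
      (continuous_of_const fun x => isEmptyElim x).isProperMap, fun a => a.2.elim⟩
  have : LindelofSpace X := .of_continuous_surjective hφ hφs
  obtain ⟨G, hG, hsat⟩ := hp.exists_continuous_preimage_subset
  refine ⟨range (G ∘ stoneCechUnit), ?_, rangeFactorization (G ∘ stoneCechUnit),
    isProperMap_rangeFactorization_of_preimage_subset isInducing_stoneCechUnit hG hsat,
    rangeFactorization_surjective⟩
  rw [← hφs.range_comp]
  exact analyticSet_range_of_isCechComplete hZ ((hG.comp continuous_stoneCechUnit).comp hφ)
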